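/- Let $p$ be a prime and let $m\ge 0$ and $n\ge 0$ be integers. Put $\eta_k(p)=\prod_{j=1}^{k}(1-p^{-j})$ for $k\ge 0$ and $\eta_\infty(p)=\prod_{j=1}^{\infty}(1-p^{-j})$. Let $\mu$ be the Haar measure on the compact additive group $\mathrm{Mat}_{n\times(n+m)}(\mathbb{Z}_p)$, normalized to have total mass $1$. For $M\in\mathrm{Mat}_{n\times(n+m)}(\mathbb{Z}_p)$ let $\mathrm{coker}\,M=\mathbb{Z}_p^{n}/M\mathbb{Z}_p^{n+m}$. For a finite abelian $p$-group $G$ let $\mathrm{rk}_p(G)=\dim_{\mathbb{F}_p}(G/pG)$ and $$w_m(G)=\frac{\eta_\infty(p)/\eta_m(p)}{|G|^m\,|\mathrm{Aut}(G)|},\qquad \lambda_m(G)=\frac{w_m(G)\,\bigl(1+p^{-m}-p^{\mathrm{rk}_p(G)}\bigr)}{p-1}.$$ Then for every finite abelian $p$-group $G$ the set $\{M:\mathrm{coker}\,M\cong G\}$ is measurable, and $$\Bigl|\mu\bigl(\{M\in\mathrm{Mat}_{n\times(n+m)}(\mathbb{Z}_p):\mathrm{coker}\,M\cong G\}\bigr)-w_m(G)-\lambda_m(G)\,p^{-n}\Bigr|\le\Bigl(\frac{\eta_m(p)^2}{\eta_\infty(p)^2}-1\Bigr)^{1/2}p^{-2n}.$$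 That is, the probability that $\mathrm{coker}\,M\cong G$ equals $w_m(G)+\lambda_m(G)p^{-n}+O(p^{-2n})$, with implied constant at most $(\eta_m(p)^2/\eta_\infty(p)^2-1)^{1/2}$. -/

import Mathlib

namespace CokernelDistribution

open MeasureTheory

/-- `η_k(q) = ∏_{j=1}^{k} (1 - q^{-j})`. -/
noncomputable def eta (k : ℕ) (q : ℝ) : ℝ :=
  ∏ j ∈ Finset.Icc 1 k, (1 - (q ^ j)⁻¹)

/-- `η_∞(q) = ∏_{j=1}^{∞} (1 - q^{-j})`; the product converges for `1 < q`, see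
`multipliable_etaInfty`. -/
noncomputable def etaInfty (q : ℝ) : ℝ :=
  ∏' j : ℕ, (1 - (q ^ (j + 1))⁻¹)

theorem multipliable_etaInfty {q : ℝ} (hq : 1 < q) :
    Multipliable fun j : ℕ => (1 - (q ^ (j + 1))⁻¹ : ℝ) := by
  have h : Summable fun j : ℕ => -(q ^ (j + 1))⁻¹ := by
    have h0 : Summable fun j : ℕ => (q⁻¹) ^ j :=
      summable_geometric_of_lt_one (by positivity) (inv_lt_one_of_one_lt₀ hq)
    have h1 := ((summable_nat_add_iff 1).2 h0).neg
    simpa [inv_pow] using h1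
  simpa [sub_eq_add_neg] using Real.multipliable_one_add_of_summable h

/-- The `p`-rank `rk_p(G) = dim_{𝔽_p} (G / pG)`. -/
noncomputable def pRank (p : ℕ) (G : Type*) [AddCommGroup G] : ℕ :=
  Module.finrank (ZMod p) (ModN G p)

/-- The Cohen–Lenstra weight `w_m(G) = (η_∞(p) / η_m(p)) / (|G|^m |Aut G|)`. -/
noncomputable def clWeight (p m : ℕ) (G : Type*) [AddCommGroup G] : ℝ :=
  (etaInfty p / eta m p) / ((Nat.card G : ℝ) ^ m * (Nat.card (AddAut G) : ℝ))

/-- The secondary coefficient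
`λ_m(G) = w_m(G) (1 + p^{-m} - p^{rk_p(G)}) / (p - 1)`. -/
noncomputable def secondWeight (p m : ℕ) (G : Type*) [AddCommGroup G] : ℝ :=
  clWeight p m G * (1 + ((p : ℝ) ^ m)⁻¹ - (p : ℝ) ^ pRank p G) / ((p : ℝ) - 1)

section Haar

variable (p : ℕ) [Fact p.Prime] (a b : ℕ)

instance : CompactSpace (Matrix (Fin a) (Fin b) ℤ_[p]) :=
  inferInstanceAs (CompactSpace (Fin a → Fin b → ℤ_[p]))

/-- Matrices over `ℤ_p` carry the Borel σ-algebra of the entrywise `p`-adic topology. -/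
noncomputable instance : MeasurableSpace (Matrix (Fin a) (Fin b) ℤ_[p]) := borel _

instance : BorelSpace (Matrix (Fin a) (Fin b) ℤ_[p]) := ⟨rfl⟩

/-- The Haar measure on the compact additive group `Mat_{a×b}(ℤ_p)`, normalized so that the
whole group has measure `1`. -/
noncomputable def haarMat : Measure (Matrix (Fin a) (Fin b) ℤ_[p]) :=
  Measure.addHaarMeasure ⊤

end Haar

/-- The cokernel `ℤ_p^a / col(M)` of an `a × b` matrix `M`, where `col(M) = M ℤ_p^b`. -/
abbrev Coker {p : ℕ} [Fact p.Prime] {a b : ℕ} (M : Matrix (Fin a) (Fin b) ℤ_[p]) : Type :=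
  (Fin a → ℤ_[p]) ⧸ LinearMap.range M.mulVecLin

/-- The set of `a × b` matrices over `ℤ_p` whose cokernel is isomorphic to `G`. -/
def cokerIsoSet (p : ℕ) [Fact p.Prime] (a b : ℕ) (G : Type*) [AddCommGroup G] :
    Set (Matrix (Fin a) (Fin b) ℤ_[p]) :=
  {M | Nonempty (Coker M ≃+ G)}

end CokernelDistribution

/-! ### Elementary product estimates and the limit defining η_∞. -/

namespace CokernelDistribution

open Filter Topology Finset

/-! With x = p^{-n} and r = rk_p(G), the probability equals w A B exactly, where w = w_m(G), A =
η_{n+m}/η_∞ and B = ∏_{i<r} (1 - p^i x) (`haarMat_cokerIsoSet_eq_clWeight_mul`). Indeed coker M ≅ G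
means that col(M) is the kernel of a surjection ℤ_p^n → G, and |Aut G| surjections share each such
kernel. Nakayama's lemma counts the surjections by working in G/pG, and likewise reduces "the
columns span K" to a count modulo pK (`haarMat_range_eq`).

It remains to expand in x. Write a = p^{-m}/(p-1) and C = η_m/η_∞ - 1. Then A = 1 + a x + R with 0 ≤
R ≤ (C - a) x², and B has linear coefficient -(p^r - 1)/(p - 1); together they give λ_m(G). The
powers of p^r in the error are absorbed by w ≤ p^{-r(r+m)}/η_r. This comes from the exact formula at
n = r: a cokernel of rank n forces M ≡ 0 mod p, and A ≥ 1. The resulting constant C is at most the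
stated square root. -/

/-- One more factor turns the remainder R into (R + x² u (σ + u)) / (1 - x u). Compared with x = 1,
the numerator gains at most x² and the denominator does not shrink, so the remainder is at most x²
times its value at 1. -/
theorem prod_inv_one_sub_bounds {s : ℕ → ℝ} (hs0 : ∀ j, 0 ≤ s j) (hs1 : ∀ j, s j < 1)
    {x : ℝ} (hx1 : x ≤ 1) (N : ℕ) :
    0 ≤ ∏ j ∈ range N, (1 - x * s j)⁻¹ - 1 - x * ∑ j ∈ range N, s j ∧
      ∏ j ∈ range N, (1 - x * s j)⁻¹ - 1 - x * ∑ j ∈ range N, s j ≤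
        x ^ 2 * (∏ j ∈ range N, (1 - s j)⁻¹ - 1 - ∑ j ∈ range N, s j) := by
  induction N with
  | zero => simp
  | succ N ih =>
    simp only [prod_range_succ, sum_range_succ]
    have hσ : 0 ≤ ∑ j ∈ range N, s j := sum_nonneg fun j _ => hs0 j
    have h0 := hs0 N
    have h1 := hs1 N
    generalize ∏ j ∈ range N, (1 - x * s j)⁻¹ = F at *
    generalize ∏ j ∈ range N, (1 - s j)⁻¹ = F1 at *
    generalize ∑ j ∈ range N, s j = σ at *
    generalize s N = u at *
    have hxu : x * u ≤ u := mul_le_of_le_one_left h0 hx1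
    have hd : 0 < 1 - x * u := by linarith
    have hd1 : 0 < 1 - u := by linarith
    have key : F * (1 - x * u)⁻¹ - 1 - x * (σ + u) =
        ((F - 1 - x * σ) + x ^ 2 * (u * (σ + u))) / (1 - x * u) := by
      field_simp
      ring
    have key1 : F1 * (1 - u)⁻¹ - 1 - (σ + u) =
        ((F1 - 1 - σ) + u * (σ + u)) / (1 - u) := by
      field_simp
      ring
    have hus : 0 ≤ u * (σ + u) := by positivity
    have hnum : 0 ≤ (F - 1 - x * σ) + x ^ 2 * (u * (σ + u)) :=
      add_nonneg ih.1 (by positivity)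
    rw [key, key1]
    refine ⟨div_nonneg hnum hd.le, ?_⟩
    rw [← mul_div_assoc]
    refine div_le_div₀ (by nlinarith [ih.2, ih.1]) ?_ hd1 (by linarith)
    linarith [ih.2]

theorem prod_one_sub_bounds {s : ℕ → ℝ} (hs0 : ∀ j, 0 ≤ s j) (hs1 : ∀ j, s j ≤ 1)
    {y : ℝ} (hy0 : 0 ≤ y) (hy1 : y ≤ 1) (r : ℕ) :
    0 ≤ ∏ j ∈ range r, (1 - y * s j) ∧ ∏ j ∈ range r, (1 - y * s j) ≤ 1 ∧
      1 - y * ∑ j ∈ range r, s j ≤ ∏ j ∈ range r, (1 - y * s j) ∧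
      ∏ j ∈ range r, (1 - y * s j) ≤
        1 - y * ∑ j ∈ range r, s j + (y * ∑ j ∈ range r, s j) ^ 2 / 2 := by
  induction r with
  | zero => simp
  | succ r ih =>
    simp only [prod_range_succ, sum_range_succ]
    have hσ : 0 ≤ ∑ j ∈ range r, s j := sum_nonneg fun j _ => hs0 j
    have h0 := hs0 r
    have h1 := hs1 r
    generalize ∏ j ∈ range r, (1 - y * s j) = B at *
    generalize ∑ j ∈ range r, s j = σ at *
    generalize s r = u at *
    have hyu0 : 0 ≤ y * u := by positivity
    have hyu : y * u ≤ 1 := mul_le_one₀ hy1 h0 h1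
    rw [mul_add]
    have hyσ : 0 ≤ y * σ := by positivity
    generalize y * σ = z at *
    generalize y * u = v at *
    obtain ⟨a, b, c, d⟩ := ih
    refine ⟨by nlinarith, by nlinarith, by nlinarith, ?_⟩
    have : B * (1 - v) ≤ B - (1 - z) * v := by nlinarith
    nlinarith

section Eta

variable {p : ℝ}

theorem one_sub_inv_pow_pos (hp : 1 < p) (j : ℕ) : 0 < 1 - (p ^ (j + 1))⁻¹ :=
  sub_pos.2 (inv_lt_one_of_one_lt₀ (one_lt_pow₀ hp (by omega)))

theorem eta_eq_prod_range (k : ℕ) (q : ℝ) :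
    eta k q = ∏ j ∈ range k, (1 - (q ^ (j + 1))⁻¹) := by
  rw [eta, range_eq_Ico, prod_Ico_add' (fun j => 1 - (q ^ j)⁻¹) 0 k 1]
  rfl

theorem eta_add (k N : ℕ) (q : ℝ) :
    eta (k + N) q = eta k q * ∏ j ∈ range N, (1 - (q ^ (k + j + 1))⁻¹) := by
  simp only [eta_eq_prod_range, prod_range_add]

theorem eta_pos (hp : 1 < p) (k : ℕ) : 0 < eta k p := by
  rw [eta_eq_prod_range]
  exact prod_pos fun j _ => one_sub_inv_pow_pos hp j

theorem quarter_le_eta (hp : 2 ≤ p) (k : ℕ) : 1 / 4 ≤ eta k p := by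
  have hq0 : 0 < p⁻¹ := by positivity
  have hq : p⁻¹ ≤ 1 / 2 := by rw [one_div]; exact inv_anti₀ two_pos hp
  -- Pentagonal-type lower bound; the extra q^{k+2} closes the induction, and 1 - q - q² ≥ 1/4 for q
  -- ≤ 1/2.
  have key : ∀ k, 1 - p⁻¹ - p⁻¹ ^ 2 + p⁻¹ ^ (k + 2) ≤ eta (k + 1) p := by
    intro k
    simp only [eta_eq_prod_range, ← inv_pow]
    generalize p⁻¹ = q at *
    induction k with
    | zero => simp
    | succ k ih =>
      rw [prod_range_succ]
      have h1 : q ^ (k + 2) ≤ q ^ 2 := pow_le_pow_of_le_one hq0.le (by linarith) (by omega)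
      have h0 : 0 < q ^ (k + 2) := by positivity
      have h2 : q ^ (k + 1 + 2) = q * q ^ (k + 2) := by ring
      have h3 : q ^ (k + 1 + 1) = q ^ (k + 2) := by ring
      rw [h2, h3]
      have h4 : 0 ≤ 1 - q ^ (k + 2) := by nlinarith
      have := mul_le_mul_of_nonneg_right ih h4
      nlinarith
  rcases k with _ | k
  · norm_num [eta]
  · have := key k
    have : 0 < p⁻¹ ^ (k + 2) := by positivity
    nlinarith

theorem tendsto_eta (hp : 1 < p) : Tendsto (fun k => eta k p) atTop (𝓝 (etaInfty p)) := by
  simp only [eta_eq_prod_range]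
  exact (multipliable_etaInfty hp).hasProd.tendsto_prod_nat

theorem etaInfty_pos (hp : 2 ≤ p) : 0 < etaInfty p :=
  lt_of_lt_of_le (by norm_num)
    (ge_of_tendsto' (tendsto_eta (by linarith)) fun k => quarter_le_eta hp k)

/-- Limit of `prod_inv_one_sub_bounds` for s_j = p^{-(m+j+1)}, x = p^{-n}: the ratio is ∏ (1 - x
s_j)⁻¹, and x = 1 gives η_m/η_∞. -/
theorem eta_div_etaInfty_bounds (hp : 2 ≤ p) (m n : ℕ) :
    0 ≤ eta (n + m) p / etaInfty p - 1 - (p ^ n)⁻¹ * ((p ^ m)⁻¹ / (p - 1)) ∧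
      eta (n + m) p / etaInfty p - 1 - (p ^ n)⁻¹ * ((p ^ m)⁻¹ / (p - 1)) ≤
        ((p ^ n)⁻¹) ^ 2 * (eta m p / etaInfty p - 1 - (p ^ m)⁻¹ / (p - 1)) := by
  have hp1 : 1 < p := by linarith
  set s : ℕ → ℝ := fun j => (p ^ (m + j + 1))⁻¹ with hs
  have hs0 : ∀ j, 0 ≤ s j := fun j => by positivity
  have hs1 : ∀ j, s j < 1 := fun j => by
    have := one_sub_inv_pow_pos hp1 (m + j); simp only [hs]; linarith
  have hx1 : (p ^ n)⁻¹ ≤ 1 := inv_le_one_of_one_le₀ (one_le_pow₀ hp1.le)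
  have hσ : Tendsto (fun N => ∑ j ∈ range N, s j) atTop (𝓝 ((p ^ m)⁻¹ / (p - 1))) := by
    have h := ((hasSum_geometric_of_lt_one (r := p⁻¹) (by positivity)
      (inv_lt_one_of_one_lt₀ hp1)).mul_left ((p ^ (m + 1))⁻¹)).tendsto_sum_nat
    have e : (p ^ (m + 1))⁻¹ * (1 - p⁻¹)⁻¹ = (p ^ m)⁻¹ / (p - 1) := by
      have : p - 1 ≠ 0 := by linarith
      field_simp
      ring
    rw [e] at h
    refine h.congr fun N => sum_congr rfl fun j _ => ?_
    simp only [hs, inv_pow, ← mul_inv, ← pow_add]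
    congr 2; ring
  have hP : ∀ k, Tendsto (fun N => ∏ j ∈ range N, (1 - (p ^ (k + j + 1))⁻¹)⁻¹) atTop
      (𝓝 (eta k p / etaInfty p)) := by
    intro k
    have h : Tendsto (fun N => eta k p / eta (N + k) p) atTop (𝓝 (eta k p / etaInfty p)) :=
      tendsto_const_nhds.div ((tendsto_add_atTop_iff_nat k).2 (tendsto_eta hp1))
        (etaInfty_pos hp).ne'
    refine h.congr fun N => ?_
    rw [add_comm N, eta_add, prod_inv_distrib, div_mul_cancel_left₀ (eta_pos hp1 k).ne']
  have hPn : Tendsto (fun N => ∏ j ∈ range N, (1 - (p ^ n)⁻¹ * s j)⁻¹) atTop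
      (𝓝 (eta (n + m) p / etaInfty p)) := by
    refine (hP (n + m)).congr fun N => prod_congr rfl fun j _ => ?_
    simp only [hs, ← mul_inv, ← pow_add]
    congr 4; ring
  have b := prod_inv_one_sub_bounds hs0 hs1 hx1
  exact ⟨ge_of_tendsto' ((hPn.sub_const 1).sub (hσ.const_mul _)) fun N => (b N).1,
    le_of_tendsto_of_tendsto' ((hPn.sub_const 1).sub (hσ.const_mul _))
      ((((hP m).sub_const 1).sub hσ).const_mul _) fun N => (b N).2⟩

end Eta

end CokernelDistribution

/-! ### Second-order error bound, by rank. -/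

namespace CokernelDistribution

open Finset

/-- The error is w (R B + a x (B - 1) + β y²), where P = p^r and y = x P. Since R B and β y² are
nonnegative and a x (B - 1) is nonpositive, `h1` controls the error from above and `h2` from below.
-/
theorem abs_expansion_le {w C a A x B b y β P : ℝ} (hw : 0 ≤ w) (hx : 0 ≤ x)
    (hxP : x * P = y) (ha : 0 ≤ a) (hβ : 0 ≤ β)
    (hR0 : 0 ≤ A - 1 - x * a) (hR : A - 1 - x * a ≤ x ^ 2 * (C - a))
    (hB0 : 0 ≤ B) (hB1 : B ≤ 1) (hB : B = 1 - b * y + β * y ^ 2)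
    (h1 : w * (C - a) + w * β * P ^ 2 ≤ C) (h2 : w * a * b * P ≤ C) :
    |w * A * B - (w + w * (a - b * P) * x)| ≤ C * x ^ 2 := by
  have e : w * A * B - (w + w * (a - b * P) * x) =
      w * ((A - 1 - x * a) * B + a * x * (B - 1) + β * y ^ 2) := by
    rw [← hxP] at hB ⊢
    linear_combination (w + w * x * a - w * a * x) * hB
  rw [e]
  generalize hRd : A - 1 - x * a = R at *
  have hax : 0 ≤ a * x := by positivity
  have hβy : 0 ≤ β * y ^ 2 := by positivity
  rw [abs_le]
  constructor
  · have l1 : -(a * x * (b * y)) ≤ R * B + a * x * (B - 1) + β * y ^ 2 := by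
      have : a * x * (B - 1) ≥ a * x * (-(b * y)) :=
        mul_le_mul_of_nonneg_left (by linarith) hax
      nlinarith [mul_nonneg hR0 hB0]
    have l2 := mul_le_mul_of_nonneg_left l1 hw
    have l3 := mul_le_mul_of_nonneg_right h2 (sq_nonneg x)
    have l4 : w * -(a * x * (b * y)) = -(w * a * b * P * x ^ 2) := by rw [← hxP]; ring
    linarith
  · have l1 : R * B + a * x * (B - 1) + β * y ^ 2 ≤ x ^ 2 * (C - a) + β * y ^ 2 := by
      have : R * B ≤ R := mul_le_of_le_one_right hR0 hB1
      nlinarith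
    have l2 := mul_le_mul_of_nonneg_left l1 hw
    have l3 := mul_le_mul_of_nonneg_right h1 (sq_nonneg x)
    have l4 : w * (x ^ 2 * (C - a) + β * y ^ 2) = (w * (C - a) + w * β * P ^ 2) * x ^ 2 := by
      rw [← hxP]; ring
    linarith

/-- Here W = w P², q = p⁻¹ and β = q³ exactly. The crude bound η_2 ≥ 1/4 loses too much in rank 2,
so the product (1 - q)(1 - q²) is kept. -/
theorem rank_two_bounds {w W t a C q : ℝ} (hq0 : 0 < q) (hq : q ≤ 1 / 2) (ht0 : 0 < t)
    (ht1 : t ≤ 1) (ha0 : 0 < a) (haq : a * (1 - q) = t * q) (haC : a ≤ C) (hW0 : 0 ≤ W)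
    (hwq : w = W * q ^ 4) (hW : W * ((1 - q) * (1 - q ^ 2)) ≤ t) :
    w * (C - a) + W * q ^ 3 ≤ C ∧ a * (W * (q ^ 3 * (1 + q))) ≤ C := by
  have hq1 : 1 / 2 ≤ 1 - q := by linarith
  have hq2 : 3 / 4 ≤ 1 - q ^ 2 := by nlinarith
  have hq12 : 3 / 8 ≤ (1 - q) * (1 - q ^ 2) := by nlinarith
  have hW4 : W ≤ 4 := by nlinarith
  have hq3 : q ^ 3 ≤ (1 / 2) ^ 3 := pow_le_pow_left₀ hq0.le hq 3
  have hq4 : q ^ 4 ≤ (1 / 2) ^ 4 := pow_le_pow_left₀ hq0.le hq 4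
  have hq3' : 0 < q ^ 3 := by positivity
  constructor
  · have h1 : w ≤ 1 / 4 := by rw [hwq]; nlinarith
    have h2 : W * q ^ 3 ≤ 3 / 4 * a := by
      have : W * q ^ 3 * ((1 - q) * (1 - q ^ 2)) ≤
          3 / 4 * a * ((1 - q) * (1 - q ^ 2)) := by
        have l1 := mul_le_mul_of_nonneg_right hW hq3'.le
        have l2 : 3 / 4 * a * ((1 - q) * (1 - q ^ 2)) = 3 / 4 * (t * q) * (1 - q ^ 2) := by
          rw [← haq]; ring
        have l3 : q ^ 2 ≤ 3 / 4 * (1 - q ^ 2) := by nlinarith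
        have l4 := mul_le_mul_of_nonneg_left l3 (show 0 ≤ t * q by positivity)
        rw [l2]
        linarith
      exact le_of_mul_le_mul_right this (by linarith)
    have := mul_le_mul_of_nonneg_right h1 (show 0 ≤ C - a by linarith)
    linarith
  · have l1 : q ^ 3 * (1 + q) ≤ 1 / 4 := by nlinarith
    have l2 : W * (q ^ 3 * (1 + q)) ≤ 1 := by nlinarith [show 0 ≤ q ^ 3 * (1 + q) by positivity]
    nlinarith

theorem rank_ge_three_bounds {w P t a C b β p : ℝ} (hw0 : 0 ≤ w)
    (ht1 : t ≤ 1) (hp : 2 ≤ p) (hat : a * (p - 1) = t) (ha0 : 0 < a) (haC : a ≤ C)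
    (hP : 1 ≤ P) (hb0 : 0 ≤ b) (hb : b * (p - 1) ≤ 1) (hβ0 : 0 ≤ β) (hβ : β ≤ b ^ 2 / 2)
    (hW : w * P ^ 2 ≤ t / 2) :
    w * (C - a) + w * β * P ^ 2 ≤ C ∧ w * a * b * P ≤ C := by
  have hb1 : b ≤ 1 := by nlinarith
  have hwP : w * P ≤ w * P ^ 2 := mul_le_mul_of_nonneg_left (by nlinarith) hw0
  have hwP1 : w ≤ w * P := le_mul_of_one_le_right hw0 hP
  constructor
  · have h2 : w * β * P ^ 2 ≤ a / 4 := by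
      have ht0 : 0 < t := by rw [← hat]; exact mul_pos ha0 (by linarith)
      have l1 : w * P ^ 2 * β ≤ t / 2 * (b ^ 2 / 2) := mul_le_mul hW hβ hβ0 (by positivity)
      have l2 : t * b ≤ a := by rw [← hat]; nlinarith
      have l3 : t * b * b ≤ a * 1 := mul_le_mul l2 hb1 hb0 ha0.le
      linarith
    have := mul_le_mul_of_nonneg_right (show w ≤ 1 / 2 by linarith) (show 0 ≤ C - a by linarith)
    linarith
  · have h2 : w * P * b ≤ 1 := mul_le_one₀ (by linarith) hb0 hb1
    rw [show w * a * b * P = a * (w * P * b) by ring]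
    exact (mul_le_of_le_one_right ha0.le h2).trans haC

/-- For n < r the probability is 0, so the main term itself must be O(x²). With y = x P ≥ p, the
squares (p - 2)² and (y - 2)² give 4 (p - 1) |1 + z| ≤ y², where z is the relative second term. -/
theorem small_dim_bound {w P t a C p x : ℝ} (hw0 : 0 ≤ w) (hp : 2 ≤ p) (ht0 : 0 < t)
    (hat : a * (p - 1) = t) (haC : a ≤ C) (hP : 2 ≤ P) (ht1 : t ≤ 1) (hx0 : 0 < x)
    (hy : p ≤ x * P) (hW : w * P ^ 2 ≤ 4 * t) :
    |0 - (w + w * ((1 + t - P) / (p - 1)) * x)| ≤ C * x ^ 2 := by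
  have hpp : 0 < p - 1 := by linarith
  have ha0 : 0 < a := by
    rw [← hat] at ht0
    exact pos_of_mul_pos_left ht0 hpp.le
  have hcx1 : (1 + t - P) / (p - 1) * x ≤ 0 :=
    mul_nonpos_of_nonpos_of_nonneg
      (div_nonpos_of_nonpos_of_nonneg (by linarith) hpp.le) hx0.le
  have hcx2 : -(x * P) ≤ (1 + t - P) / (p - 1) * x * (p - 1) := by
    rw [mul_right_comm, div_mul_cancel₀ _ hpp.ne']
    nlinarith
  rw [zero_sub, abs_neg, mul_assoc w]
  generalize (1 + t - P) / (p - 1) * x = z at *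
  have habs : 4 * (p - 1) * |1 + z| ≤ (x * P) ^ 2 := by
    generalize x * P = y at *
    have h4 : 4 * (p - 1) * |1 + z| = |4 * (p - 1) * (1 + z)| := by
      rw [abs_mul, abs_of_pos (show 0 < 4 * (p - 1) by linarith)]
    rw [h4]
    have hy2 : p ^ 2 ≤ y ^ 2 := pow_le_pow_left₀ (by linarith) hy 2
    have hz : (p - 1) * z ≤ 0 := mul_nonpos_of_nonneg_of_nonpos hpp.le hcx1
    exact abs_le.2 ⟨by linarith [sq_nonneg (y - 2)], by linarith [sq_nonneg (p - 2)]⟩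
  rw [show w + w * z = w * (1 + z) by ring, abs_mul, abs_of_nonneg hw0]
  refine le_of_mul_le_mul_right ?_ (show 0 < P ^ 2 by positivity)
  have hz0 := abs_nonneg (1 + z)
  calc w * |1 + z| * P ^ 2 = w * P ^ 2 * |1 + z| := by ring
    _ ≤ 4 * t * |1 + z| := mul_le_mul_of_nonneg_right hW hz0
    _ = a * (4 * (p - 1) * |1 + z|) := by rw [← hat]; ring
    _ ≤ C * (x * P) ^ 2 := mul_le_mul haC habs (by positivity) (by linarith)
    _ = C * x ^ 2 * P ^ 2 := by ring

theorem le_one_of_mul_eta_one_le {p w : ℝ} {m : ℕ} (hp : 2 ≤ p) (hw0 : 0 ≤ w)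
    (ht1 : (p ^ m)⁻¹ ≤ 1) (hw : w * eta 1 p ≤ ((p ^ 1) ^ 1 * (p ^ m) ^ 1)⁻¹) : w ≤ 1 := by
  have hq : p⁻¹ ≤ 1 / 2 := by rw [one_div]; exact inv_anti₀ two_pos hp
  have hq0 : 0 < p⁻¹ := by positivity
  simp only [eta, Icc_self, prod_singleton, pow_one] at hw
  have : (p * p ^ m)⁻¹ ≤ p⁻¹ * 1 := by
    rw [mul_inv]; exact mul_le_mul_of_nonneg_left ht1 hq0.le
  nlinarith

/-- Second-order error bound for `x ↦ w A(x) ∏_{i<r} (1 - p^i x)` at `x = p^{-n}`, where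
`A(p^{-n}) = η_{n+m} / η_∞`, as soon as `w` is at most `p^{-r(r+m)} / η_r`. -/
theorem abs_weight_mul_sub_le {p : ℝ} (hp : 2 ≤ p) (m n r : ℕ) {w : ℝ} (hw0 : 0 ≤ w)
    (hw : w * eta r p ≤ (p ^ (r * (r + m)))⁻¹) :
    |w * (eta (n + m) p / etaInfty p) * ∏ i ∈ range r, (1 - p ^ i * (p ^ n)⁻¹) -
        (w + w * (1 + (p ^ m)⁻¹ - p ^ r) / (p - 1) * (p ^ n)⁻¹)| ≤
      (eta m p / etaInfty p - 1) * ((p ^ n)⁻¹) ^ 2 := by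
  have hp1 : 1 < p := by linarith
  have hpp : 0 < p - 1 := by linarith
  obtain ⟨hR0, hR⟩ := eta_div_etaInfty_bounds hp m n
  obtain ⟨ha1, -⟩ := eta_div_etaInfty_bounds hp m 0
  rw [pow_zero, inv_one, one_mul, zero_add] at ha1
  have ht0 : 0 < (p ^ m)⁻¹ := by positivity
  have ht1 : (p ^ m)⁻¹ ≤ 1 := inv_le_one_of_one_le₀ (one_le_pow₀ hp1.le)
  have hx0 : 0 < (p ^ n)⁻¹ := by positivity
  rw [mul_add, pow_add, pow_mul, pow_mul'] at hw
  have hq : p⁻¹ ≤ 1 / 2 := by rw [one_div]; exact inv_anti₀ two_pos hp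
  have hq0 : 0 < p⁻¹ := by positivity
  have hη := quarter_le_eta hp r
  have hw4 : w * (p ^ r) ^ r ≤ 4 * ((p ^ m)⁻¹) ^ r := by
    have h1 : w * (1 / 4) ≤ w * eta r p := mul_le_mul_of_nonneg_left hη hw0
    have h2 : w ≤ 4 * (((p ^ r) ^ r)⁻¹ * ((p ^ m) ^ r)⁻¹) := by
      rw [← mul_inv]; linarith
    calc w * (p ^ r) ^ r ≤ 4 * (((p ^ r) ^ r)⁻¹ * ((p ^ m) ^ r)⁻¹) * (p ^ r) ^ r :=
          mul_le_mul_of_nonneg_right h2 (by positivity)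
      _ = 4 * ((p ^ m)⁻¹) ^ r := by rw [inv_pow]; field_simp
  have ha0 : 0 < (p ^ m)⁻¹ / (p - 1) := by positivity
  have haC : (p ^ m)⁻¹ / (p - 1) ≤ eta m p / etaInfty p - 1 := by linarith
  have hat : (p ^ m)⁻¹ / (p - 1) * (p - 1) = (p ^ m)⁻¹ := div_mul_cancel₀ _ hpp.ne'
  -- The exponent r(r+m) leaves a surplus p^{-r(r-2)} beyond P⁻²: at most 1/8 once r ≥ 3, but
  -- nothing when r = 2.
  have hbound2 : 2 ≤ r → w * (p ^ r) ^ 2 ≤ 4 * (p ^ m)⁻¹ * (p⁻¹ ^ r) ^ (r - 2) := by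
    intro hr
    have e : (p ^ r) ^ r = (p ^ r) ^ 2 * (p ^ r) ^ (r - 2) := by
      rw [← pow_add]; congr 1; omega
    have h3 : ((p ^ m)⁻¹) ^ r ≤ (p ^ m)⁻¹ := pow_le_of_le_one ht0.le ht1 (by omega)
    have h4 : w * (p ^ r) ^ 2 = w * (p ^ r) ^ r * (p⁻¹ ^ r) ^ (r - 2) := by
      rw [e, inv_pow, inv_pow]; field_simp
    rw [h4]
    exact mul_le_mul_of_nonneg_right (by linarith) (by positivity)
  generalize hC : eta m p / etaInfty p - 1 = C at *
  generalize hA : eta (n + m) p / etaInfty p = A at *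
  generalize had : (p ^ m)⁻¹ / (p - 1) = a at *
  rcases lt_or_ge n r with hnr | hnr
  · -- the probability vanishes
    rw [prod_eq_zero (mem_range.2 hnr) (by rw [mul_inv_cancel₀ (by positivity), sub_self])]
    rcases Nat.lt_or_ge r 2 with hr | hr
    -- The only case n < r ≤ 1; the main term is exactly w a.
    · obtain rfl : r = 1 := by omega
      obtain rfl : n = 0 := by omega
      have hw1 : w ≤ 1 := le_one_of_mul_eta_one_le hp hw0 ht1 hw
      have e : w * A * 0 - (w + w * (1 + (p ^ m)⁻¹ - p ^ 1) / (p - 1) * (p ^ 0)⁻¹) =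
          -(w * a) := by
        rw [← had]; field_simp; ring
      rw [e, abs_neg, abs_of_nonneg (by positivity)]
      simp only [pow_zero, inv_one, one_pow, mul_one]
      exact (mul_le_of_le_one_left ha0.le hw1).trans haC
    · have hb := hbound2 hr
      have h1 : (p⁻¹ ^ r) ^ (r - 2) ≤ 1 :=
        pow_le_one₀ (by positivity) (pow_le_one₀ hq0.le (by linarith))
      have hW : w * (p ^ r) ^ 2 ≤ 4 * (p ^ m)⁻¹ :=
        hb.trans (mul_le_of_le_one_right (by positivity) h1)
      have hy : p ≤ (p ^ n)⁻¹ * p ^ r := by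
        rw [inv_mul_eq_div, le_div_iff₀ (by positivity), ← pow_succ']
        exact pow_le_pow_right₀ hp1.le hnr
      have hPr : 2 ≤ p ^ r := hp.trans (le_self_pow₀ hp1.le (by omega))
      rw [mul_div_assoc]
      rw [mul_zero]
      exact small_dim_bound hw0 hp ht0 hat haC hPr ht1 hx0 hy hW
  · obtain ⟨d, rfl⟩ := Nat.exists_eq_add_of_le hnr
    have hxP : (p ^ (r + d))⁻¹ * p ^ r = p⁻¹ ^ d := by
      rw [pow_add, inv_pow]; field_simp
    have hy0 : 0 < p⁻¹ ^ d := by positivity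
    have hy1 : p⁻¹ ^ d ≤ 1 := pow_le_one₀ hq0.le (by linarith)
    -- Reversing the product with i = r - 1 - j, d = n - r gives p^i x = p^{-d} p^{-(j+1)}, so B is
    -- a polynomial in y = p^{-d} with linear coefficient -b.
    have hBe : ∏ i ∈ range r, (1 - p ^ i * (p ^ (r + d))⁻¹) =
        ∏ j ∈ range r, (1 - p⁻¹ ^ d * p⁻¹ ^ (j + 1)) := by
      rw [← prod_range_reflect]
      refine prod_congr rfl fun j hj => ?_
      have hj := mem_range.1 hj
      have : p ^ (r + d) = p ^ (r - 1 - j) * (p ^ d * p ^ (j + 1)) := by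
        rw [← pow_add, ← pow_add]; congr 1; omega
      rw [this, inv_pow, inv_pow]; field_simp
    have hbs : (∑ j ∈ range r, p⁻¹ ^ (j + 1)) * p ^ r = (p ^ r - 1) / (p - 1) := by
      rw [← geom_sum_eq (by linarith), sum_mul, ← sum_range_reflect]
      refine sum_congr rfl fun j hj => ?_
      have hj := mem_range.1 hj
      have : p ^ r = p ^ (r - 1 - j + 1) * p ^ j := by
        rw [← pow_add]; congr 1; omega
      rw [this, inv_pow]; field_simp
    have hc : w * (1 + (p ^ m)⁻¹ - p ^ r) / (p - 1) =
        w * (a - (∑ j ∈ range r, p⁻¹ ^ (j + 1)) * p ^ r) := by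
      rw [hbs, ← had]; field_simp; ring
    obtain ⟨hB0, hB1, hBl, hBu⟩ := prod_one_sub_bounds (s := fun j => p⁻¹ ^ (j + 1))
      (fun j => by positivity) (fun j => pow_le_one₀ hq0.le (by linarith)) hy0.le hy1 r
    have hb1 : (∑ j ∈ range r, p⁻¹ ^ (j + 1)) * (p - 1) ≤ 1 := by
      have hPr : 0 < p ^ r := by positivity
      refine le_of_mul_le_mul_right ?_ hPr
      rw [mul_right_comm, hbs, div_mul_cancel₀ _ hpp.ne']
      linarith
    have hb0 : 0 ≤ ∑ j ∈ range r, p⁻¹ ^ (j + 1) := sum_nonneg fun j _ => by positivity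
    rw [hBe, hc]
    have haq : a * (1 - p⁻¹) = (p ^ m)⁻¹ * p⁻¹ := by rw [← had]; field_simp
    rcases Nat.lt_or_ge r 3 with hr | hr
    · interval_cases r
      · refine abs_expansion_le (β := 0) hw0 hx0.le hxP ha0.le le_rfl hR0 hR hB0 hB1
          (by simp) ?_ (by simp; linarith)
        simp only [eta, Order.lt_one_iff, Icc_eq_empty_of_lt, prod_empty, pow_zero, mul_one,
          inv_one] at hw
        have := mul_le_of_le_one_left ha1 hw
        linarith only [this, ha0]
      · have hw1 : w ≤ 1 := le_one_of_mul_eta_one_le hp hw0 ht1 hw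
        refine abs_expansion_le (β := 0) hw0 hx0.le hxP ha0.le le_rfl hR0 hR hB0 hB1
          (by simp; ring) ?_ ?_
        · have := mul_le_of_le_one_left ha1 hw1
          linarith only [this, ha0]
        · simp only [range_one, sum_singleton, zero_add, pow_one]
          rw [mul_assoc _ p⁻¹, inv_mul_cancel₀ (by positivity), mul_one]
          exact (mul_le_of_le_one_left ha0.le hw1).trans haC
      · have hW : w * (p ^ 2) ^ 2 * ((1 - p⁻¹) * (1 - p⁻¹ ^ 2)) ≤ (p ^ m)⁻¹ := by
          have h := mul_le_mul_of_nonneg_right hw (show 0 ≤ (p ^ 2) ^ 2 by positivity)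
          have e : eta 2 p = (1 - p⁻¹) * (1 - p⁻¹ ^ 2) := by
            simp [eta_eq_prod_range, prod_range_succ]
          rw [e] at h
          have e2 : ((p ^ 2) ^ 2 * (p ^ m) ^ 2)⁻¹ * (p ^ 2) ^ 2 = ((p ^ m)⁻¹) ^ 2 := by
            field_simp
          rw [e2, mul_right_comm] at h
          exact h.trans (pow_le_of_le_one ht0.le ht1 two_ne_zero)
        have hwq : w = w * (p ^ 2) ^ 2 * p⁻¹ ^ 4 := by rw [inv_pow]; field_simp
        have hwb : w * a * (∑ j ∈ range 2, p⁻¹ ^ (j + 1)) * p ^ 2 =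
            a * (w * (p ^ 2) ^ 2 * (p⁻¹ ^ 3 * (1 + p⁻¹))) := by
          simp only [sum_range_succ, sum_range_zero, zero_add, pow_one, inv_pow]; field_simp; ring
        have hW0 : 0 ≤ w * (p ^ 2) ^ 2 := by positivity
        obtain ⟨h1, h2⟩ := rank_two_bounds hq0 hq ht0 ht1 ha0 haq haC hW0 hwq hW
        exact abs_expansion_le (β := p⁻¹ ^ 3) hw0 hx0.le hxP ha0.le (by positivity)
          hR0 hR hB0 hB1 (by simp [prod_range_succ, sum_range_succ]; ring)
          (by linarith) (hwb ▸ h2)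
    · have hb := hbound2 (by omega)
      have h1 : (p⁻¹ ^ r) ^ (r - 2) ≤ 1 / 8 := by
        rw [← pow_mul]
        have h3 : 3 ≤ r * (r - 2) := by
          calc 3 = 3 * 1 := rfl
            _ ≤ r * (r - 2) := Nat.mul_le_mul hr (by omega)
        calc p⁻¹ ^ (r * (r - 2)) ≤ p⁻¹ ^ 3 := pow_le_pow_of_le_one hq0.le (by linarith) h3
          _ ≤ (1 / 2) ^ 3 := pow_le_pow_left₀ hq0.le hq 3
          _ = 1 / 8 := by norm_num
      have hW : w * (p ^ r) ^ 2 ≤ (p ^ m)⁻¹ / 2 := by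
        have := mul_le_mul_of_nonneg_left h1 (show 0 ≤ 4 * (p ^ m)⁻¹ by positivity)
        linarith
      have hPr : 1 ≤ p ^ r := one_le_pow₀ hp1.le
      generalize ∑ j ∈ range r, p⁻¹ ^ (j + 1) = b at *
      generalize ∏ j ∈ range r, (1 - p⁻¹ ^ d * p⁻¹ ^ (j + 1)) = B at *
      generalize p⁻¹ ^ d = y at *
      -- β is defined as the normalized remainder of B; the Bonferroni-type bounds place it in [0,
      -- b²/2].
      have hβy : (B - 1 + b * y) / y ^ 2 * y ^ 2 = B - 1 + b * y :=
        div_mul_cancel₀ _ (by positivity)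
      have hβ : (B - 1 + b * y) / y ^ 2 ≤ b ^ 2 / 2 := by
        rw [div_le_iff₀ (by positivity)]
        linarith only [hBu, mul_pow y b 2]
      have hβ0 : 0 ≤ (B - 1 + b * y) / y ^ 2 := div_nonneg (by linarith only [hBl]) (by positivity)
      generalize (B - 1 + b * y) / y ^ 2 = β at *
      obtain ⟨h1, h2⟩ := rank_ge_three_bounds hw0 ht1 hp hat ha0 haC hPr hb0 hb1 hβ0 hβ hW
      exact abs_expansion_le hw0 hx0.le hxP ha0.le hβ0 hR0 hR hB0 hB1 (by linarith only [hβy]) h1 h2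

end CokernelDistribution

/-! ### Counting spanning tuples; Nakayama over ℤ_p. -/

namespace CokernelDistribution

open Finset Module Submodule

section LinearAlgebra

/-- The number of spanning `b`-tuples in a finite-dimensional space over a finite field. -/
theorem card_spanning_tuples {F V : Type*} [Field F] [Finite F] [AddCommGroup V] [Module F V]
    [Finite V] (b : ℕ) :
    Nat.card {v : Fin b → V // span F (Set.range v) = ⊤} =
      ∏ i ∈ range (finrank F V), (Nat.card F ^ b - Nat.card F ^ i) := by
  have := Fintype.ofFinite F
  have hV : Module.Finite F V := Module.Finite.of_finite
  set r := finrank F V with hr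
  let e : V ≃ₗ[F] (Fin r → F) := (finBasis F V).equivFun
  let E : (Fin b → V) ≃ (Fin r → Fin b → F) :=
    (Equiv.piCongrRight fun _ => e.toEquiv).trans (Equiv.piComm _)
  -- Row rank equals column rank: the columns of an r × b matrix span iff its r rows are
  -- independent.
  have key : ∀ v : Fin b → V, span F (Set.range v) = ⊤ ↔ LinearIndependent F (E v) := by
    intro v
    have h1 : (Matrix.of (E v)).rank = finrank F (span F (Set.range v)) := by
      rw [Matrix.rank_eq_finrank_span_cols, ← LinearEquiv.finrank_map_eq e, map_span,
        ← Set.range_comp]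
      rfl
    have h2 := Matrix.rank_eq_finrank_span_row (Matrix.of (E v))
    rw [linearIndependent_iff_card_eq_finrank_span, Fintype.card_fin, Set.finrank]
    change _ ↔ r = finrank F (span F (Set.range (Matrix.of (E v)).row))
    rw [← h2, h1]
    constructor
    · intro h; rw [h, finrank_top]
    · intro h; exact eq_top_of_finrank_eq h.symm
  rw [Nat.card_congr (E.subtypeEquiv (q := fun s => LinearIndependent F s) key)]
  rcases le_or_gt r b with h | h
  · rw [card_linearIndependent (by simpa using h), ← Fin.prod_univ_eq_prod_range]
    simp [Nat.card_eq_fintype_card]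
  · rw [prod_eq_zero (f := fun i => Nat.card F ^ b - Nat.card F ^ i) (Finset.mem_range.2 h)
      (Nat.sub_self _), Nat.card_eq_zero]
    left
    refine ⟨fun s => ?_⟩
    have := s.2.fintype_card_le_finrank
    simp at this
    omega

/-- Tuples spanning a submodule are the same as spanning tuples of that submodule. -/
def spanningTuplesEquiv {R W ι : Type*} [Ring R] [AddCommGroup W] [Module R W]
    (N : Submodule R W) :
    {u : ι → W // span R (Set.range u) = N} ≃ {v : ι → N // span R (Set.range v) = ⊤} where
  toFun u := ⟨fun j => ⟨u.1 j, u.2.le (subset_span ⟨j, rfl⟩)⟩, by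
    apply map_injective_of_injective N.injective_subtype
    rw [map_span, ← Set.range_comp, Submodule.map_top, range_subtype]
    exact u.2⟩
  invFun v := ⟨fun j => v.1 j, by
    have := congrArg (map N.subtype) v.2
    rwa [map_span, ← Set.range_comp, Submodule.map_top, range_subtype] at this⟩
  left_inv _ := rfl
  right_inv _ := rfl

theorem span_eq_top_iff_of_surjective {R S M : Type*} [CommRing R] [CommRing S] [Algebra R S]
    [AddCommGroup M] [Module R M] [Module S M] [IsScalarTower R S M]
    (h : Function.Surjective (algebraMap R S)) (X : Set M) :
    span R X = ⊤ ↔ span S X = ⊤ := by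
  rw [← restrictScalars_span R S h, restrictScalars_eq_top_iff]

theorem card_preimage_mul_card {A Q : Type*} [AddGroup A] [AddGroup Q] [Finite A] [Finite Q]
    {f : A →+ Q} (hf : Function.Surjective f) (T : Set Q) :
    Nat.card (f ⁻¹' T) * Nat.card Q = Nat.card T * Nat.card A := by
  classical
  have := Fintype.ofFinite A
  have := Fintype.ofFinite Q
  have hc : ∀ q : Q, #{a | f a = q} = #{a | f a = 0} := fun q =>
    AddMonoidHom.card_fiber_eq_of_mem_range f (hf q) (hf 0)
  have h1 : ∀ T : Finset Q, #{a | f a ∈ T} = #T * #{a | f a = 0} := by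
    intro T
    rw [card_eq_sum_card_fiberwise (f := f) (t := T) (by intro a; simp)]
    rw [sum_congr rfl (g := fun _ => #{a | f a = 0}), sum_const, smul_eq_mul]
    intro q hq
    rw [← hc q, filter_filter]
    congr 1
    ext a
    simp only [mem_filter, mem_univ, true_and, and_iff_right_iff_imp]
    rintro rfl
    exact hq
  have h2 := h1 univ
  have h3 := h1 T.toFinset
  simp only [mem_univ, filter_true, card_univ] at h2
  have e1 : Nat.card (f ⁻¹' T) = #{a | f a ∈ T.toFinset} := by
    rw [Nat.card_eq_fintype_card, Fintype.card_subtype]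
    congr 1
    ext a
    simp
  have e2 : Nat.card T = #T.toFinset := by
    rw [Nat.card_eq_fintype_card, Set.toFinset_card]
  rw [e1, e2, h3, Nat.card_eq_fintype_card, Nat.card_eq_fintype_card, h2]
  ring

end LinearAlgebra

section Padic

variable {p : ℕ} [Fact p.Prime]

local notation "𝔪" => IsLocalRing.maximalIdeal ℤ_[p]

theorem mem_maximalIdeal_smul {M : Type*} [AddCommGroup M] [Module ℤ_[p] M]
    {N : Submodule ℤ_[p] M} {x : M} : x ∈ 𝔪 • N ↔ ∃ y ∈ N, (p : ℤ_[p]) • y = x := by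
  rw [PadicInt.maximalIdeal_eq_span_p, ideal_span_singleton_smul]
  exact mem_smul_pointwise_iff_exists x _ N

/-- Nakayama's lemma. The v j are not assumed to lie in N: equality of images in M/𝔪N gives span +
𝔪N = N, which already forces this. -/
theorem span_eq_iff_map_mkQ {M ι : Type*} [AddCommGroup M] [Module ℤ_[p] M]
    {N : Submodule ℤ_[p] M} (hN : N.FG) (v : ι → M) :
    span ℤ_[p] (Set.range v) = N ↔
      span ℤ_[p] (Set.range fun j => (𝔪 • N).mkQ (v j)) = N.map (𝔪 • N).mkQ := by
  have e : span ℤ_[p] (Set.range fun j => (𝔪 • N).mkQ (v j)) =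
      (span ℤ_[p] (Set.range v)).map (𝔪 • N).mkQ := by
    rw [map_span, ← Set.range_comp]; rfl
  rw [e]
  refine ⟨fun h => by rw [h], fun h => ?_⟩
  have h' := congrArg (comap (𝔪 • N).mkQ) h
  rw [comap_map_mkQ, comap_map_mkQ, sup_eq_right.2 (smul_le_right : 𝔪 • N ≤ N)] at h'
  refine le_antisymm (le_sup_right.trans h'.le) ?_
  exact le_of_le_smul_of_le_jacobson_bot hN
    (IsLocalRing.jacobson_eq_maximalIdeal _ bot_ne_top).ge (by rw [sup_comm]; exact h'.ge)

theorem card_spanning_tuples_of_module_zmod {V : Type*} [AddCommGroup V] [Module ℤ_[p] V]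
    [Module (ZMod p) V] [Finite V] (hV : ∀ v : V, (p : ℤ_[p]) • v = 0) {d : ℕ}
    (hd : Nat.card V = p ^ d) (b : ℕ) :
    Nat.card {v : Fin b → V // span ℤ_[p] (Set.range v) = ⊤} =
      ∏ i ∈ range d, (p ^ b - p ^ i) := by
  let _ : Algebra ℤ_[p] (ZMod p) := PadicInt.toZMod.toAlgebra
  have hmul : ∀ (z : ℤ_[p]) (v : V), (algebraMap ℤ_[p] (ZMod p) z) • v = z • v := by
    intro z v
    have h := PadicInt.toZMod_spec z
    rw [PadicInt.maximalIdeal_eq_span_p, Ideal.mem_span_singleton] at h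
    obtain ⟨y, hy⟩ := h
    have hz : z = p * y + ((PadicInt.toZMod z).val : ℤ_[p]) := by
      rw [← hy, ZMod.natCast_val]; ring
    have e1 : z • v = (PadicInt.toZMod z).val • v := by
      conv_lhs => rw [hz]
      rw [add_smul, mul_smul, hV, zero_add, Nat.cast_smul_eq_nsmul]
    rw [e1]
    conv_lhs => rw [RingHom.algebraMap_toAlgebra, ← ZMod.natCast_zmod_val (PadicInt.toZMod z)]
    rw [Nat.cast_smul_eq_nsmul]
  have : IsScalarTower ℤ_[p] (ZMod p) V := IsScalarTower.of_algebraMap_smul hmul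
  have hsur : Function.Surjective (algebraMap ℤ_[p] (ZMod p)) := ZMod.ringHom_surjective _
  have hVf : Module.Finite (ZMod p) V := Module.Finite.of_finite
  have hfr : finrank (ZMod p) V = d := by
    have := natCard_eq_pow_finrank (K := ZMod p) (V := V)
    rw [hd, Nat.card_zmod] at this
    exact (Nat.pow_right_injective (Fact.out : p.Prime).two_le this).symm
  rw [Nat.card_congr (Equiv.subtypeEquivRight fun v : Fin b → V =>
    span_eq_top_iff_of_surjective hsur (Set.range v)), card_spanning_tuples, hfr, Nat.card_zmod]

theorem card_spanning_tuples_of_torsion {V : Type*} [AddCommGroup V] [Module ℤ_[p] V] [Finite V]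
    (hV : ∀ v : V, (p : ℤ_[p]) • v = 0) {d : ℕ} (hd : Nat.card V = p ^ d) (b : ℕ) :
    Nat.card {v : Fin b → V // span ℤ_[p] (Set.range v) = ⊤} =
      ∏ i ∈ range d, (p ^ b - p ^ i) := by
  have : Module (ZMod p) V :=
    AddCommGroup.zmodModule fun v => by rw [← hV v, Nat.cast_smul_eq_nsmul]
  exact card_spanning_tuples_of_module_zmod hV hd b

theorem smul_mkQ_maximalIdeal_smul_eq_zero {M : Type*} [AddCommGroup M] [Module ℤ_[p] M]
    {N : Submodule ℤ_[p] M} {x : M} (hx : x ∈ N) : (p : ℤ_[p]) • (𝔪 • N).mkQ x = 0 := by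
  rw [← map_smul, mkQ_apply, Submodule.Quotient.mk_eq_zero]
  exact mem_maximalIdeal_smul.2 ⟨x, hx, rfl⟩

theorem card_quotient_maximalIdeal_smul_top (n : ℕ) :
    Nat.card ((Fin n → ℤ_[p]) ⧸ (𝔪 • ⊤ : Submodule ℤ_[p] (Fin n → ℤ_[p]))) = p ^ n := by
  let f : (Fin n → ℤ_[p]) →+ (Fin n → ZMod p) :=
    { toFun := fun x i => PadicInt.toZMod (x i)
      map_zero' := by ext; simp
      map_add' := fun x y => by ext; simp }
  have hf : Function.Surjective f := fun y =>
    ⟨fun i => ((y i).val : ℤ_[p]), by ext i; simp [f]⟩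
  have hker : f.ker = (𝔪 • ⊤ : Submodule ℤ_[p] (Fin n → ℤ_[p])).toAddSubgroup := by
    ext x
    have h1 : ∀ i, PadicInt.toZMod (x i) = 0 ↔ ∃ y, (p : ℤ_[p]) * y = x i := by
      intro i
      rw [← RingHom.mem_ker, PadicInt.ker_toZMod, PadicInt.maximalIdeal_eq_span_p,
        Ideal.mem_span_singleton]
      exact ⟨fun ⟨y, hy⟩ => ⟨y, hy.symm⟩, fun ⟨y, hy⟩ => ⟨y, hy.symm⟩⟩
    rw [AddMonoidHom.mem_ker, mem_toAddSubgroup, mem_maximalIdeal_smul]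
    constructor
    · intro h
      choose y hy using fun i => (h1 i).1 (congrFun h i)
      exact ⟨y, mem_top, funext hy⟩
    · rintro ⟨y, -, hy⟩
      exact funext fun i => (h1 i).2 ⟨y i, congrFun hy i⟩
  have h := AddSubgroup.index_ker f
  rw [hker, AddMonoidHom.range_eq_top.2 hf] at h
  change Nat.card _ = _ at h
  refine h.trans ?_
  simp

/-- Multiplication by p is injective and carries K ⊆ ℤ_p^n to pK ⊆ pℤ_p^n; the index follows without
choosing a basis of K. -/
theorem card_quotient_maximalIdeal_smul {n : ℕ} (K : Submodule ℤ_[p] (Fin n → ℤ_[p])) :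
    Nat.card ((Fin n → ℤ_[p]) ⧸ (𝔪 • K)) = Nat.card ((Fin n → ℤ_[p]) ⧸ K) * p ^ n := by
  let φ : (Fin n → ℤ_[p]) →+ (Fin n → ℤ_[p]) := DistribSMul.toAddMonoidHom _ (p : ℤ_[p])
  have hφ : Function.Injective φ := smul_right_injective _ (by
    exact_mod_cast (Fact.out : p.Prime).ne_zero)
  have h := AddSubgroup.index_map_of_injective K.toAddSubgroup hφ
  have e1 : K.toAddSubgroup.map φ = (𝔪 • K).toAddSubgroup := by
    ext x
    rw [mem_toAddSubgroup, mem_maximalIdeal_smul]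
    rfl
  have e2 : φ.range = (𝔪 • ⊤ : Submodule ℤ_[p] (Fin n → ℤ_[p])).toAddSubgroup := by
    ext x
    rw [mem_toAddSubgroup, mem_maximalIdeal_smul]
    simp [φ]
  rw [e1, e2] at h
  rw [← card_quotient_maximalIdeal_smul_top (p := p) n]
  exact h

end Padic

end CokernelDistribution

/-! ### Haar measure of finite-level conditions. -/

namespace CokernelDistribution

open Finset Module Submodule MeasureTheory

variable {p : ℕ} [Fact p.Prime] {a b n : ℕ}

local notation "𝔪" => IsLocalRing.maximalIdeal ℤ_[p]

instance : (haarMat p a b).IsAddHaarMeasure := by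
  unfold haarMat
  infer_instance

instance : IsProbabilityMeasure (haarMat p a b) :=
  ⟨Measure.addHaarMeasure_self (K₀ := (⊤ : TopologicalSpace.PositiveCompacts _))⟩

theorem isClosed_submodule (N : Submodule ℤ_[p] (Matrix (Fin a) (Fin b) ℤ_[p])) :
    IsClosed (N : Set (Matrix (Fin a) (Fin b) ℤ_[p])) := by
  obtain ⟨k, f, hf⟩ := (fg_iff_exists_fin_linearMap _ _).1 (IsNoetherian.noetherian N)
  have hc : Continuous f := by
    have : (f : (Fin k → ℤ_[p]) → Matrix (Fin a) (Fin b) ℤ_[p]) =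
        fun x => ∑ i, x i • f (fun j => if i = j then 1 else 0) := by
      ext1 x
      exact f.pi_apply_eq_sum_univ x
    rw [this]
    fun_prop
  rw [← hf, LinearMap.coe_range]
  exact (isCompact_range hc).isClosed

/-- The fibres are translates of the closed kernel, hence measurable of equal measure, and they
partition a space of mass 1. -/
theorem measurableSet_preimage_and_real {Q : Type*} [AddCommGroup Q] [Module ℤ_[p] Q] [Finite Q]
    {φ : Matrix (Fin a) (Fin b) ℤ_[p] →ₗ[ℤ_[p]] Q} (hφ : Function.Surjective φ) (T : Set Q) :
    MeasurableSet (φ ⁻¹' T) ∧ (haarMat p a b).real (φ ⁻¹' T) * Nat.card Q = Nat.card T := by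
  classical
  have := Fintype.ofFinite Q
  have hker : MeasurableSet (LinearMap.ker φ : Set (Matrix (Fin a) (Fin b) ℤ_[p])) :=
    (isClosed_submodule _).measurableSet
  have htr : ∀ M, φ ⁻¹' {φ M} = (fun x => -M + x) ⁻¹' (LinearMap.ker φ) := by
    intro M
    ext x
    simp only [Set.mem_preimage, Set.mem_singleton_iff, SetLike.mem_coe, LinearMap.mem_ker,
      map_add, map_neg, neg_add_eq_zero]
    exact eq_comm
  have hms : ∀ q, MeasurableSet (φ ⁻¹' {q}) := by
    intro q
    obtain ⟨M, rfl⟩ := hφ q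
    rw [htr]
    exact measurable_const_add (-M) hker
  have hre : ∀ q, (haarMat p a b).real (φ ⁻¹' {q}) = (haarMat p a b).real (LinearMap.ker φ) := by
    intro q
    obtain ⟨M, rfl⟩ := hφ q
    rw [htr, measureReal_def, measure_preimage_add, measureReal_def]
  have hun : ∀ T : Set Q, φ ⁻¹' T = ⋃ q ∈ T.toFinset, φ ⁻¹' {q} := by
    intro T
    ext x
    simp
  have hT : ∀ T : Set Q, (haarMat p a b).real (φ ⁻¹' T) =
      Nat.card T * (haarMat p a b).real (LinearMap.ker φ) := by
    intro T
    rw [hun, measureReal_biUnion_finset _ fun q _ => hms q]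
    · rw [sum_congr rfl fun q _ => hre q, sum_const, nsmul_eq_mul, Set.toFinset_card,
        Nat.card_eq_fintype_card]
    · intro q _ q' _ hqq
      exact Set.disjoint_left.2 fun x hx hx' => hqq (hx.symm.trans hx')
  refine ⟨?_, ?_⟩
  · rw [hun]
    exact Finset.measurableSet_biUnion _ fun q _ => hms q
  · have h1 := hT Set.univ
    rw [Set.preimage_univ, probReal_univ, Nat.card_coe_set_eq, Set.ncard_univ] at h1
    rw [hT, mul_assoc, mul_comm _ (Nat.card Q : ℝ), ← h1, mul_one]

/-- Reduction of the columns of a matrix modulo a submodule. -/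
noncomputable def colsMod (N : Submodule ℤ_[p] (Fin a → ℤ_[p])) (b : ℕ) :
    Matrix (Fin a) (Fin b) ℤ_[p] →ₗ[ℤ_[p]] Fin b → (Fin a → ℤ_[p]) ⧸ N where
  toFun M j := N.mkQ (M.col j)
  map_add' _ _ := rfl
  map_smul' _ _ := rfl

theorem colsMod_surjective (N : Submodule ℤ_[p] (Fin a → ℤ_[p])) :
    Function.Surjective (colsMod N b) := by
  intro y
  choose x hx using fun j => N.mkQ_surjective (y j)
  exact ⟨Matrix.of fun i j => x j i, funext hx⟩

theorem finite_quotient_maximalIdeal_smul (K : Submodule ℤ_[p] (Fin n → ℤ_[p]))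
    [Finite ((Fin n → ℤ_[p]) ⧸ K)] : Finite ((Fin n → ℤ_[p]) ⧸ (𝔪 • K)) := by
  apply Nat.finite_of_card_ne_zero
  rw [card_quotient_maximalIdeal_smul]
  exact mul_ne_zero Nat.card_pos.ne' (pow_ne_zero _ (Fact.out : p.Prime).ne_zero)

/-- If d > b, truncated subtraction is harmless: the factor i = b vanishes on both sides. -/
theorem cast_prod_pow_sub_pow {p : ℕ} (hp : 0 < p) {d b : ℕ} :
    ((∏ i ∈ range d, (p ^ b - p ^ i) : ℕ) : ℝ) =
      ((p : ℝ) ^ b) ^ d * ∏ i ∈ range d, (1 - (p : ℝ) ^ i * ((p : ℝ) ^ b)⁻¹) := by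
  have hp0 : (p : ℝ) ≠ 0 := by exact_mod_cast hp.ne'
  rcases le_or_gt d b with h | h
  · have hc : ((p : ℝ) ^ b) ^ d = ∏ _i ∈ range d, (p : ℝ) ^ b := by simp
    rw [Nat.cast_prod, hc, ← prod_mul_distrib]
    refine prod_congr rfl fun i hi => ?_
    have hi : i ≤ b := by have := Finset.mem_range.1 hi; omega
    rw [Nat.cast_sub (Nat.pow_le_pow_right hp hi)]
    push_cast
    field_simp
  · rw [prod_eq_zero (f := fun i => p ^ b - p ^ i) (Finset.mem_range.2 h) (Nat.sub_self _),
      prod_eq_zero (f := fun i => 1 - (p : ℝ) ^ i * ((p : ℝ) ^ b)⁻¹) (Finset.mem_range.2 h)]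
    · simp
    · rw [mul_inv_cancel₀ (pow_ne_zero _ hp0), sub_self]

/-- By Nakayama the event depends only on the columns modulo pK, and K/pK has p^n elements whatever
K is. Only the index of K therefore enters. -/
theorem haarMat_range_eq (K : Submodule ℤ_[p] (Fin n → ℤ_[p])) [Finite ((Fin n → ℤ_[p]) ⧸ K)] :
    MeasurableSet {M : Matrix (Fin n) (Fin b) ℤ_[p] | LinearMap.range M.mulVecLin = K} ∧
    (haarMat p n b).real {M | LinearMap.range M.mulVecLin = K} *
        (Nat.card ((Fin n → ℤ_[p]) ⧸ K) : ℝ) ^ b =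
      ∏ i ∈ range n, (1 - (p : ℝ) ^ i * ((p : ℝ) ^ b)⁻¹) := by
  have := finite_quotient_maximalIdeal_smul K
  have hp : 0 < (p : ℝ) := by exact_mod_cast (Fact.out : p.Prime).pos
  set T : Set (Fin b → (Fin n → ℤ_[p]) ⧸ (𝔪 • K)) :=
    {u | span ℤ_[p] (Set.range u) = K.map (𝔪 • K).mkQ} with hT
  have hpre : {M : Matrix (Fin n) (Fin b) ℤ_[p] | LinearMap.range M.mulVecLin = K} =
      colsMod (𝔪 • K) b ⁻¹' T := by
    ext M
    rw [Set.mem_ofPred_eq, Matrix.range_mulVecLin, span_eq_iff_map_mkQ (IsNoetherian.noetherian K)]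
    rfl
  have hcard : Nat.card (K.map (𝔪 • K).mkQ) = p ^ n := by
    have h := card_quotient_mul_card_quotient K (𝔪 • K) smul_le_right
    rw [card_quotient_maximalIdeal_smul, mul_comm] at h
    exact Nat.eq_of_mul_eq_mul_left Nat.card_pos h
  have hcT : Nat.card T = ∏ i ∈ range n, (p ^ b - p ^ i) := by
    rw [← card_spanning_tuples_of_torsion (p := p) (V := K.map (𝔪 • K).mkQ) _ hcard b]
    · exact Nat.card_congr (spanningTuplesEquiv _)
    · rintro ⟨v, x, hx, rfl⟩
      exact Subtype.ext (smul_mkQ_maximalIdeal_smul_eq_zero hx)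
  obtain ⟨h1, h2⟩ := measurableSet_preimage_and_real (colsMod_surjective (b := b) (𝔪 • K)) T
  rw [← hpre] at h1 h2
  refine ⟨h1, ?_⟩
  rw [hcT, cast_prod_pow_sub_pow (Fact.out : p.Prime).pos, Nat.card_pi, prod_const, card_univ,
    Fintype.card_fin, card_quotient_maximalIdeal_smul] at h2
  push_cast at h2
  rw [mul_pow, ← mul_assoc, ← pow_mul, ← pow_mul, mul_comm n b, mul_comm _ ((p : ℝ) ^ (b * n))] at h2
  exact mul_left_cancel₀ (by positivity) h2

end CokernelDistribution

/-! ### The exact cokernel distribution. -/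

namespace CokernelDistribution

open Finset Module Submodule MeasureTheory

variable {p : ℕ} [Fact p.Prime] {a b n : ℕ} {G : Type*} [AddCommGroup G] [Module ℤ_[p] G]

local notation "𝔪" => IsLocalRing.maximalIdeal ℤ_[p]

/-- Modulo p^k every p-adic integer is a natural number, and p^k kills the target. -/
theorem map_smul_of_torsion {A : Type*} [AddCommGroup A] [Module ℤ_[p] A] {k : ℕ}
    (hk : ∀ g : G, p ^ k • g = 0) (f : A →+ G) (z : ℤ_[p]) (x : A) : f (z • x) = z • f x := by
  have h := PadicInt.appr_spec k z
  rw [Ideal.mem_span_singleton] at h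
  obtain ⟨y, hy⟩ := h
  have hz : z = ((p ^ k : ℕ) : ℤ_[p]) * y + (z.appr k : ℤ_[p]) := by
    push_cast
    rw [← hy]; ring
  rw [hz, add_smul, add_smul, mul_smul, mul_smul, Nat.cast_smul_eq_nsmul, Nat.cast_smul_eq_nsmul,
    Nat.cast_smul_eq_nsmul, Nat.cast_smul_eq_nsmul, map_add, map_nsmul, map_nsmul, hk, hk]

/-- An additive map into a `p`-power torsion group is `ℤ_p`-linear. -/
def toPadicLinearMap {A : Type*} [AddCommGroup A] [Module ℤ_[p] A] {k : ℕ}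
    (hk : ∀ g : G, p ^ k • g = 0) (f : A →+ G) : A →ₗ[ℤ_[p]] G :=
  { f with map_smul' := map_smul_of_torsion hk f }

theorem card_quotient_eq_pow_pRank [Finite G] :
    Nat.card (G ⧸ (𝔪 • ⊤ : Submodule ℤ_[p] G)) = p ^ pRank p G := by
  have : Finite (ModN G p) := 
    Finite.of_surjective _ (LinearMap.range (LinearMap.lsmul ℤ G (p : ℤ))).mkQ_surjective
  have hf : Module.Finite (ZMod p) (ModN G p) := Module.Finite.of_finite
  have h := natCard_eq_pow_finrank (K := ZMod p) (V := ModN G p)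
  rw [Nat.card_zmod] at h
  refine Eq.trans ?_ h
  have e : (𝔪 • ⊤ : Submodule ℤ_[p] G).toAddSubgroup =
      (LinearMap.range (LinearMap.lsmul ℤ G p)).toAddSubgroup := by
    ext x
    rw [mem_toAddSubgroup, mem_toAddSubgroup, mem_maximalIdeal_smul]
    simp [Nat.cast_smul_eq_nsmul]
  exact congrArg AddSubgroup.index e

theorem card_generating_tuples [Finite G] (n : ℕ) :
    (Nat.card {v : Fin n → G // span ℤ_[p] (Set.range v) = ⊤} : ℝ) =
      (Nat.card G : ℝ) ^ n *
        ∏ i ∈ range (pRank p G), (1 - (p : ℝ) ^ i * ((p : ℝ) ^ n)⁻¹) := by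
  have hp : 0 < (p : ℝ) := by exact_mod_cast (Fact.out : p.Prime).pos
  set N : Submodule ℤ_[p] G := 𝔪 • ⊤ with hN
  have : Finite (G ⧸ N) := Finite.of_surjective _ N.mkQ_surjective
  let f : (Fin n → G) →+ (Fin n → G ⧸ N) :=
    { toFun := fun v j => N.mkQ (v j), map_zero' := rfl, map_add' := fun _ _ => rfl }
  have hf : Function.Surjective f := fun y => by
    choose x hx using fun j => N.mkQ_surjective (y j)
    exact ⟨x, funext hx⟩
  have h := card_preimage_mul_card hf {u | span ℤ_[p] (Set.range u) = ⊤}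
  have e1 : f ⁻¹' {u | span ℤ_[p] (Set.range u) = ⊤} = {v | span ℤ_[p] (Set.range v) = ⊤} := by
    ext v
    have := span_eq_iff_map_mkQ (N := (⊤ : Submodule ℤ_[p] G)) (IsNoetherian.noetherian _) v
    rw [Submodule.map_top, range_mkQ] at this
    exact this.symm
  have e2 := card_spanning_tuples_of_torsion (p := p) (V := G ⧸ N) (fun v => by
    obtain ⟨x, rfl⟩ := N.mkQ_surjective v
    exact smul_mkQ_maximalIdeal_smul_eq_zero mem_top) card_quotient_eq_pow_pRank n
  rw [e1] at h
  change Nat.card {v : Fin n → G // span ℤ_[p] (Set.range v) = ⊤} * _ =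
    Nat.card {v : Fin n → G ⧸ N // span ℤ_[p] (Set.range v) = ⊤} * _ at h
  rw [e2, Nat.card_pi, Nat.card_pi, prod_const, prod_const, card_univ, Fintype.card_fin,
    card_quotient_eq_pow_pRank] at h
  have h' := congrArg (Nat.cast (R := ℝ)) h
  rw [Nat.cast_mul, Nat.cast_mul, cast_prod_pow_sub_pow (Fact.out : p.Prime).pos] at h'
  push_cast at h'
  rw [← pow_mul, ← pow_mul, mul_comm n, mul_comm, mul_assoc] at h'
  have := mul_left_cancel₀ (by positivity) h'
  rw [this, mul_comm]

/-- The number of ways to present `G` as the cokernel of `M`. -/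
theorem card_presentations {k : ℕ} (hk : ∀ g : G, p ^ k • g = 0)
    {M : Matrix (Fin n) (Fin b) ℤ_[p]} (e : Coker M ≃+ G) :
    Nat.card {v : {v : Fin n → G // span ℤ_[p] (Set.range v) = ⊤} //
      LinearMap.range M.mulVecLin = LinearMap.ker (Fintype.linearCombination ℤ_[p] v.1)} =
      Nat.card (AddAut G) := by
  let g : (Fin n → ℤ_[p]) →ₗ[ℤ_[p]] G :=
    (toPadicLinearMap hk e.toAddMonoidHom).comp (LinearMap.range M.mulVecLin).mkQ
  have hgs : Function.Surjective g := e.surjective.comp (mkQ_surjective _)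
  have hgk : LinearMap.ker g = LinearMap.range M.mulVecLin := by
    ext x
    rw [LinearMap.mem_ker, ← Submodule.Quotient.mk_eq_zero, ← e.map_eq_zero_iff]
    rfl
  have hlc : ∀ h : (Fin n → ℤ_[p]) →ₗ[ℤ_[p]] G,
      Fintype.linearCombination ℤ_[p] (fun i => h (Pi.single i 1)) = h := by
    intro h
    ext i
    simp
  have hspan : ∀ h : (Fin n → ℤ_[p]) →ₗ[ℤ_[p]] G, Function.Surjective h →
      span ℤ_[p] (Set.range fun i => h (Pi.single i 1)) = ⊤ := by
    intro h hs
    rw [← Fintype.range_linearCombination, hlc, LinearMap.range_eq_top.2 hs]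
  -- Surjections with kernel col(M) form a torsor under Aut(G), with base point g.
  let c : AddAut G → (Fin n → ℤ_[p]) →ₗ[ℤ_[p]] G := fun σ =>
    (toPadicLinearMap hk (AddEquiv.toAddMonoidHom σ)).comp g
  have hc : ∀ σ x, c σ x = σ (g x) := fun σ x => rfl
  have hcs : ∀ σ, Function.Surjective (c σ) := fun σ => (AddEquiv.surjective σ).comp hgs
  have hck : ∀ σ, LinearMap.ker (c σ) = LinearMap.range M.mulVecLin := by
    intro σ
    rw [← hgk]
    ext x
    rw [LinearMap.mem_ker, LinearMap.mem_ker, hc, AddEquiv.map_eq_zero_iff]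
  symm
  refine Nat.card_congr (Equiv.ofBijective
    (fun σ => ⟨⟨fun i => c σ (Pi.single i 1), hspan _ (hcs σ)⟩, by rw [hlc, hck]⟩) ⟨?_, ?_⟩)
  · intro σ τ h
    have h1 : (fun i => c σ (Pi.single i 1)) = fun i => c τ (Pi.single i 1) :=
      congrArg (fun w => w.1.1) h
    have h2 : c σ = c τ := by rw [← hlc (c σ), h1, hlc]
    ext y
    obtain ⟨x, rfl⟩ := hgs y
    exact LinearMap.congr_fun h2 x
  · rintro ⟨⟨v, hv⟩, hM⟩
    set f := Fintype.linearCombination ℤ_[p] v with hf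
    have hfs : Function.Surjective f := by
      rw [← LinearMap.range_eq_top, hf, Fintype.range_linearCombination, hv]
    let σ : G ≃ₗ[ℤ_[p]] G := (g.quotKerEquivOfSurjective hgs).symm.trans
      ((quotEquivOfEq _ _ (hgk.trans hM)).trans (f.quotKerEquivOfSurjective hfs))
    have hσ : ∀ x, σ (g x) = f x := by
      intro x
      have : (g.quotKerEquivOfSurjective hgs).symm (g x) = (LinearMap.ker g).mkQ x := by
        rw [LinearEquiv.symm_apply_eq]; rfl
      simp only [σ, LinearEquiv.trans_apply, this]
      rfl
    refine ⟨σ.toAddEquiv, ?_⟩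
    ext i
    change σ (g (Pi.single i 1)) = v i
    rw [hσ, hf]
    simp

/-- The exact distribution of the cokernel. -/
theorem haarMat_cokerIsoSet [Finite G] {k : ℕ} (hk : ∀ g : G, p ^ k • g = 0) (n b : ℕ) :
    MeasurableSet (cokerIsoSet p n b G) ∧
    (haarMat p n b).real (cokerIsoSet p n b G) * Nat.card (AddAut G) * (Nat.card G : ℝ) ^ b =
      (Nat.card G : ℝ) ^ n *
        (∏ i ∈ range (pRank p G), (1 - (p : ℝ) ^ i * ((p : ℝ) ^ n)⁻¹)) *
        ∏ i ∈ range n, (1 - (p : ℝ) ^ i * ((p : ℝ) ^ b)⁻¹) := by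
  classical
  let S := {v : Fin n → G // span ℤ_[p] (Set.range v) = ⊤}
  have := Fintype.ofFinite S
  let K : S → Submodule ℤ_[p] (Fin n → ℤ_[p]) :=
    fun v => LinearMap.ker (Fintype.linearCombination ℤ_[p] v.1)
  let E : S → Set (Matrix (Fin n) (Fin b) ℤ_[p]) := fun v => {M | LinearMap.range M.mulVecLin = K v}
  have hs : ∀ v : S, Function.Surjective (Fintype.linearCombination ℤ_[p] v.1) := by
    intro v
    rw [← LinearMap.range_eq_top, Fintype.range_linearCombination, v.2]
  let q : ∀ v : S, ((Fin n → ℤ_[p]) ⧸ K v) ≃ₗ[ℤ_[p]] G := fun v =>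
    LinearMap.quotKerEquivOfSurjective _ (hs v)
  have hE : ∀ v, MeasurableSet (E v) ∧ (haarMat p n b).real (E v) * (Nat.card G : ℝ) ^ b =
      ∏ i ∈ range n, (1 - (p : ℝ) ^ i * ((p : ℝ) ^ b)⁻¹) := by
    intro v
    have : Finite ((Fin n → ℤ_[p]) ⧸ K v) := Finite.of_equiv G (q v).symm.toEquiv
    have h := haarMat_range_eq (b := b) (K v)
    rwa [Nat.card_congr (q v).toEquiv] at h
  have hU : cokerIsoSet p n b G = ⋃ v, E v := by
    ext M
    simp only [cokerIsoSet, Set.mem_ofPred_eq, Set.mem_iUnion]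
    constructor
    · rintro ⟨e⟩
      have h := card_presentations hk e
      have : Finite (AddAut G) := Finite.of_injective (fun σ : AddAut G => (σ : G → G))
        DFunLike.coe_injective
      have hpos : 0 < Nat.card (AddAut G) := Nat.card_pos
      rw [← h, Nat.card_pos_iff] at hpos
      obtain ⟨⟨v, hv⟩⟩ := hpos.1
      exact ⟨v, hv⟩
    · rintro ⟨v, hv⟩
      exact ⟨((quotEquivOfEq _ _ hv).trans (q v)).toAddEquiv⟩
  have hm : MeasurableSet (cokerIsoSet p n b G) := by
    rw [hU]
    exact MeasurableSet.iUnion fun v => (hE v).1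
  refine ⟨hm, ?_⟩
  -- The sets E v overlap: each M in the event lies in exactly |Aut G| of them. Integrating this
  -- identity gives the measure.
  have hind : ∀ M, ∑ v, (E v).indicator (1 : Matrix (Fin n) (Fin b) ℤ_[p] → ℝ) M =
      (cokerIsoSet p n b G).indicator (fun _ => (Nat.card (AddAut G) : ℝ)) M := by
    intro M
    by_cases hM : M ∈ cokerIsoSet p n b G
    · rw [Set.indicator_of_mem hM]
      obtain ⟨e⟩ := hM
      rw [← card_presentations hk e, Nat.card_eq_fintype_card, Fintype.card_subtype]
      simp only [Set.indicator_apply, Pi.one_apply, card_filter, Nat.cast_sum]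
      refine sum_congr rfl fun v _ => ?_
      push_cast
      exact if_congr Iff.rfl rfl rfl
    · rw [Set.indicator_of_notMem hM]
      refine sum_eq_zero fun v _ => Set.indicator_of_notMem (fun h => hM ?_) _
      rw [hU]
      exact Set.mem_iUnion.2 ⟨v, h⟩
  have hsum : ∑ v, (haarMat p n b).real (E v) =
      (haarMat p n b).real (cokerIsoSet p n b G) * Nat.card (AddAut G) := by
    have h1 : ∑ v, (haarMat p n b).real (E v) =
        ∫ M, ∑ v, (E v).indicator (1 : Matrix (Fin n) (Fin b) ℤ_[p] → ℝ) M ∂(haarMat p n b) := by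
      rw [integral_finsetSum]
      · exact sum_congr rfl fun v _ => (integral_indicator_one (hE v).1).symm
      · intro v _
        exact (integrable_const (1 : ℝ)).indicator (hE v).1
    rw [h1, integral_congr_ae (Filter.Eventually.of_forall hind), integral_indicator_const _ hm,
      smul_eq_mul]
  rw [← hsum, sum_mul, sum_congr rfl fun v _ => (hE v).2, sum_const, nsmul_eq_mul, card_univ,
    ← Nat.card_eq_fintype_card, card_generating_tuples]

/-- A matrix with `n` rows whose cokernel has rank `n` vanishes modulo `p`. -/
theorem haarMat_cokerIsoSet_pRank_le [Finite G] {k : ℕ} (hk : ∀ g : G, p ^ k • g = 0) (b : ℕ) :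
    (haarMat p (pRank p G) b).real (cokerIsoSet p (pRank p G) b G) ≤
      ((p : ℝ) ^ (pRank p G * b))⁻¹ := by
  set n := pRank p G with hn
  have hp : 0 < p := (Fact.out : p.Prime).pos
  set N : Submodule ℤ_[p] (Fin n → ℤ_[p]) := 𝔪 • ⊤ with hN
  have hcN : Nat.card ((Fin n → ℤ_[p]) ⧸ N) = p ^ n := card_quotient_maximalIdeal_smul_top n
  have : Finite ((Fin n → ℤ_[p]) ⧸ N) :=
    Nat.finite_of_card_ne_zero (by rw [hcN]; positivity)
  have h := (measurableSet_preimage_and_real (colsMod_surjective (b := b) N) {0}).2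
  have hsub : cokerIsoSet p n b G ⊆ colsMod N b ⁻¹' {0} := by
    rintro M ⟨e⟩
    let g : (Fin n → ℤ_[p]) →ₗ[ℤ_[p]] G :=
      (toPadicLinearMap hk e.toAddMonoidHom).comp (LinearMap.range M.mulVecLin).mkQ
    have hgs : Function.Surjective g := e.surjective.comp (mkQ_surjective _)
    have hN' : N ≤ (𝔪 • ⊤ : Submodule ℤ_[p] G).comap g := by
      rw [hN, ← map_le_iff_le_comap, map_smul'']
      exact smul_mono_right _ le_top
    -- A surjection between sets of size p^n is injective, so columns dying in G vanish modulo p.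
    have hbij : Function.Bijective (mapQ N (𝔪 • ⊤ : Submodule ℤ_[p] G) g hN') := by
      refine (Nat.bijective_iff_surjective_and_card _).2 ⟨?_, ?_⟩
      · intro y
        obtain ⟨y, rfl⟩ := mkQ_surjective _ y
        obtain ⟨x, rfl⟩ := hgs y
        exact ⟨N.mkQ x, rfl⟩
      · rw [hcN, card_quotient_eq_pow_pRank]
    refine funext fun j => hbij.1 ?_
    have hcol : g (M.col j) = 0 := by
      have : (LinearMap.range M.mulVecLin).mkQ (M.col j) = 0 := by
        rw [mkQ_apply, Submodule.Quotient.mk_eq_zero, Matrix.range_mulVecLin]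
        exact subset_span ⟨j, rfl⟩
      change (toPadicLinearMap hk e.toAddMonoidHom) ((LinearMap.range M.mulVecLin).mkQ (M.col j)) = 0
      rw [this, map_zero]
    change mkQ _ (g (M.col j)) = _
    rw [hcol, map_zero, Pi.zero_apply, map_zero]
  refine (measureReal_mono hsub).trans ?_
  rw [Nat.card_pi, prod_const, card_univ, Fintype.card_fin, hcN, Nat.card_unique] at h
  rw [← one_div, le_div_iff₀ (by positivity), pow_mul]
  exact_mod_cast h.le

theorem prod_eq_eta_div_eta {p : ℝ} (hp : 1 < p) (m n : ℕ) :
    ∏ i ∈ range n, (1 - p ^ i * (p ^ (n + m))⁻¹) = eta (n + m) p / eta m p := by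
  rw [add_comm n m, eta_add, mul_div_cancel_left₀ _ (eta_pos hp m).ne', ← prod_range_reflect]
  refine prod_congr rfl fun j hj => ?_
  have hj := Finset.mem_range.1 hj
  have : p ^ (m + n) = p ^ (n - 1 - j) * p ^ (m + j + 1) := by
    rw [← pow_add]; congr 1; omega
  rw [this]
  field_simp

theorem haarMat_cokerIsoSet_eq_clWeight_mul [Finite G] {k : ℕ} (hk : ∀ g : G, p ^ k • g = 0)
    (m n : ℕ) :
    (haarMat p n (n + m)).real (cokerIsoSet p n (n + m) G) =
      clWeight p m G * (eta (n + m) p / etaInfty p) *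
        ∏ i ∈ range (pRank p G), (1 - (p : ℝ) ^ i * ((p : ℝ) ^ n)⁻¹) := by
  have hp : 2 ≤ (p : ℝ) := by exact_mod_cast (Fact.out : p.Prime).two_le
  have h := (haarMat_cokerIsoSet hk n (n + m)).2
  rw [prod_eq_eta_div_eta (by linarith)] at h
  have : Finite (AddAut G) := Finite.of_injective (fun σ : AddAut G => (σ : G → G))
    DFunLike.coe_injective
  have hA : 0 < (Nat.card (AddAut G) : ℝ) := by exact_mod_cast Nat.card_pos
  have hG : 0 < (Nat.card G : ℝ) := by exact_mod_cast Nat.card_pos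
  have h1 := eta_pos (p := (p : ℝ)) (by linarith) m
  have h2 := etaInfty_pos hp
  rw [clWeight]
  rw [pow_add] at h
  refine mul_right_cancel₀ (b := (Nat.card (AddAut G) : ℝ) *
    ((Nat.card G : ℝ) ^ n * (Nat.card G : ℝ) ^ m)) (by positivity) ?_
  rw [← mul_assoc, h]
  field_simp

end CokernelDistribution

/-! ### Conclusion. -/

open CokernelDistribution Finset in
theorem theorem1p3 (p : ℕ) [Fact p.Prime] (m n : ℕ) (G : Type*) [AddCommGroup G] [Finite G]
    (hG : IsPGroup p (Multiplicative G)) :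
    MeasurableSet (CokernelDistribution.cokerIsoSet p n (n + m) G) ∧
    |(CokernelDistribution.haarMat p n (n + m)).real
          (CokernelDistribution.cokerIsoSet p n (n + m) G)
        - (CokernelDistribution.clWeight p m G
            + CokernelDistribution.secondWeight p m G * ((p : ℝ) ^ n)⁻¹)|
      ≤ Real.sqrt (CokernelDistribution.eta m p ^ 2 / CokernelDistribution.etaInfty p ^ 2 - 1)
          * ((p : ℝ) ^ (2 * n))⁻¹ := by
  have hp : 2 ≤ (p : ℝ) := by exact_mod_cast (Fact.out : p.Prime).two_le
  obtain ⟨k, hcard⟩ := IsPGroup.iff_card.1 hG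
  have hk : ∀ g : G, p ^ k • g = 0 := fun g => by
    rw [← hcard]
    exact card_nsmul_eq_zero' (x := g)
  let _ : Module (ZMod (p ^ k)) G := AddCommGroup.zmodModule hk
  let _ : Module ℤ_[p] G := Module.compHom G (PadicInt.toZModPow k : ℤ_[p] →+* ZMod (p ^ k))
  refine ⟨(haarMat_cokerIsoSet hk n (n + m)).1, ?_⟩
  have hw0 : 0 ≤ clWeight p m G := by
    have h1 := eta_pos (p := (p : ℝ)) (by linarith) m
    have h2 := etaInfty_pos hp
    rw [clWeight]
    positivity
  have hA : ∀ j, 1 ≤ eta (j + m) p / etaInfty p := fun j => by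
    have h := (eta_div_etaInfty_bounds hp m j).1
    have : 0 ≤ ((p : ℝ) ^ j)⁻¹ * (((p : ℝ) ^ m)⁻¹ / (p - 1)) := by
      have : 0 < (p : ℝ) - 1 := by linarith
      positivity
    linarith
  -- The exact formula at n = r reads w A η_r, and A ≥ 1 can be dropped.
  have hw : clWeight p m G * eta (pRank p G) p ≤
      ((p : ℝ) ^ (pRank p G * (pRank p G + m)))⁻¹ := by
    have h := haarMat_cokerIsoSet_pRank_le hk (pRank p G + m)
    have e := prod_eq_eta_div_eta (p := (p : ℝ)) (by linarith) 0 (pRank p G)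
    rw [add_zero, show eta 0 (p : ℝ) = 1 by simp [eta], div_one] at e
    rw [haarMat_cokerIsoSet_eq_clWeight_mul hk, e, mul_right_comm] at h
    refine le_trans (le_mul_of_one_le_right ?_ (hA _)) h
    exact mul_nonneg hw0 (eta_pos (by linarith) _).le
  have hmain := abs_weight_mul_sub_le hp m n (pRank p G) hw0 hw
  rw [haarMat_cokerIsoSet_eq_clWeight_mul hk, secondWeight]
  refine hmain.trans ?_
  rw [mul_comm 2 n, pow_mul, inv_pow]
  refine mul_le_mul_of_nonneg_right ?_ (by positivity)
  have h1 := hA 0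
  rw [zero_add] at h1
  rw [← div_pow]
  -- (X - 1)² ≤ X² - 1 for X = η_m/η_∞ ≥ 1.
  exact Real.le_sqrt_of_sq_le (by nlinarith)
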